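/- For each integer $n\ge 1$ let $P_n$ be the classical Curie–Weiss measure at the critical inverse temperature $\beta=1$, that is, the probability measure on $\mathbb{R}^n$ (carried by $\{-1,+1\}^n$) $$dP_n(x)=\frac{1}{Z_n}\exp\Bigl(\frac{1}{2n}\Bigl(\sum_{i=1}^n x_i\Bigr)^2\Bigr)\prod_{i=1}^n d\varrho(x_i),\qquad \varrho=\tfrac12\delta_{-1}+\tfrac12\delta_1,$$ where $Z_n$ is the normalizing constant, and let $S_n(x)=\sum_{i=1}^n x_i$ be the total magnetization. Put $$F(z)=\frac1Z\int_{-\infty}^z \exp(-x^4/12)\,dx,\qquad Z=\int_{\mathbb{R}}\exp(-x^4/12)\,dx .$$ Then there is an absolute constant $C$ such that for every $n\ge1$ $$\sup_{z\in\mathbb{R}}\Bigl|P_n\bigl(S_n/n^{3/4}\le z\bigr)-F(z)\Bigr|\le C\,n^{-1/2}.$$ -/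

import Mathlib

open MeasureTheory

noncomputable section

/-- The symmetric Bernoulli measure `(δ₋₁ + δ₁) / 2` on `ℝ`. -/
def symmetricBernoulli : Measure ℝ :=
  (2⁻¹ : ENNReal) • Measure.dirac (-1) + (2⁻¹ : ENNReal) • Measure.dirac 1

/-- The total magnetization `S_n = x_1 + ⋯ + x_n` of a spin configuration. -/
def magnetization {n : ℕ} (x : Fin n → ℝ) : ℝ := ∑ i, x i

/-- The Curie–Weiss measure `P_{n,β}` on `ℝⁿ` with single-spin distribution `ϱ`: the probability
measure with density proportional to `exp (β / (2 n) * S_n ^ 2)` with respect to `ϱ^{⊗ n}`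
(`Measure.tilted` divides by the partition function). -/
def curieWeissMeasure (ϱ : Measure ℝ) (β : ℝ) (n : ℕ) : Measure (Fin n → ℝ) :=
  (Measure.pi fun _ : Fin n => ϱ).tilted fun x => β / (2 * (n : ℝ)) * magnetization x ^ 2

/-- The distribution function of the probability measure on `ℝ` with Lebesgue density
proportional to `exp (-x ^ 4 / 12)`. -/
def quarticCDF (z : ℝ) : ℝ :=
  (∫ x : ℝ, Real.exp (-x ^ 4 / 12))⁻¹ * ∫ x in Set.Iic z, Real.exp (-x ^ 4 / 12)

/-- The quantity `|P_n (S_n / n ^ (3/4) ≤ z) - F z|` for the classical Curie–Weiss model at the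
critical inverse temperature `β = 1`. -/
def criticalDiscrepancy (n : ℕ) (z : ℝ) : ℝ :=
  |(curieWeissMeasure symmetricBernoulli 1 n).real
      {x | magnetization x / (n : ℝ) ^ (3 / 4 : ℝ) ≤ z} - quarticCDF z|

end

/-! With k = 2j - n, the law of S_n gives k a mass proportional to w_j = C(n,j) exp(k²/(2n)). At β =
1 the interaction cancels the Gaussian part of the binomial coefficient, and log w_j falls from its
central value like -k⁴/(12n³), which is -y⁴/12 when k = y n^(3/4).

No Stirling formula is used. Ratios of adjacent weights are explicit, and the artanh series bounds
their logarithms (`log_curieWeissWeight_succ`, `abs_drift_add_le`). Summing from the centre gives an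
error of order (1 + y² + y⁶)/√n for |y| ≤ n^(1/4)/2 (`abs_log_weight_sub_add_le`). A cruder bound on
the whole range (`log_weight_sub_le`) supplies decay exp(-y⁴/96), so the normalised weight differs
from exp(-x⁴/12) by O(n^(-1/2))/(1 + x²) for x near the atom (`abs_weight_div_sub_le`).

Each atom then owns a cell of length 2n^(-3/4) centred at it. Integrating the pointwise bound over
the cells costs O(n^(-1/2)), uniformly in the number of cells; the partial cell at z and the tails
beyond n^(1/4) cost no more. The partition function is compared with Z in the same way. -/

/-! ### Law of the magnetization under the product measure -/

open Finset in
theorem lintegral_comp_magnetization (n : ℕ) {f : ℝ → ENNReal} (hf : Measurable f) :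
    ∫⁻ x, f (magnetization x) ∂(Measure.pi fun _ : Fin n => symmetricBernoulli) =
      ∑ p ∈ antidiagonal n, (n.choose p.1 : ENNReal) * (2⁻¹ ^ n * f ((p.1 : ℝ) - p.2)) := by
  have : IsProbabilityMeasure symmetricBernoulli := ⟨by
    simp [symmetricBernoulli, ENNReal.inv_two_add_inv_two]⟩
  have hmag : ∀ m, Measurable (magnetization (n := m)) := fun m => by
    unfold magnetization; fun_prop
  induction n generalizing f with
  | zero => simp [magnetization]
  | succ n ih =>
    have hmp := (measurePreserving_piFinSuccAbove
      (fun _ : Fin (n + 1) => symmetricBernoulli) 0).symm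
    rw [← hmp.lintegral_comp (f := fun x => f (magnetization x)) (hf.comp (hmag _)),
      lintegral_prod]
    · have hcons : ∀ (a : ℝ) (x : Fin n → ℝ),
          magnetization ((MeasurableEquiv.piFinSuccAbove (fun _ : Fin (n + 1) => ℝ) 0).symm (a, x))
            = a + magnetization x := fun a x => by
        simp [magnetization, MeasurableEquiv.piFinSuccAbove, Fin.sum_univ_succ]
      simp only [hcons]
      have h1 : ∀ a : ℝ, ∫⁻ x, f (a + magnetization x)
          ∂(Measure.pi fun _ : Fin n => symmetricBernoulli) = _ :=
        fun a => ih (f := fun y => f (a + y)) (hf.comp (measurable_const_add a))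
      simp only [h1]
      -- The two values of the peeled-off spin match the two terms of Pascal's rule.
      rw [sum_antidiagonal_choose_succ_mul
        (fun i j => (2⁻¹ : ENNReal) ^ (n + 1) * f ((i : ℝ) - j))]
      simp only [symmetricBernoulli, lintegral_add_measure, lintegral_smul_measure,
        lintegral_dirac, smul_eq_mul, mul_sum]
      congr 1
      · refine sum_congr rfl fun p _ => ?_
        rw [show ((p.1 : ℝ) - ((p.2 + 1 : ℕ) : ℝ)) = -1 + (p.1 - p.2) by push_cast; ring]
        ring
      · refine sum_congr rfl fun p hp => ?_
        rw [show (((p.1 + 1 : ℕ) : ℝ) - (p.2 : ℝ)) = 1 + (p.1 - p.2) by push_cast; ring,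
          Nat.choose_symm_of_eq_add (mem_antidiagonal.1 hp).symm]
        ring
    · exact ((hf.comp (hmag _)).comp (MeasurableEquiv.measurable _)).aemeasurable

open Finset in
theorem map_magnetization (n : ℕ) :
    (Measure.pi fun _ : Fin n => symmetricBernoulli).map magnetization =
      ∑ j ∈ range (n + 1), ((n.choose j : ENNReal) * 2⁻¹ ^ n) •
        Measure.dirac (2 * (j : ℝ) - n) := by
  have hmag : Measurable (magnetization (n := n)) := by unfold magnetization; fun_prop
  refine Measure.ext_of_lintegral _ fun f hf => ?_
  rw [lintegral_map hf hmag, lintegral_comp_magnetization n hf,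
    Nat.sum_antidiagonal_eq_sum_range_succ_mk, lintegral_finsetSum_measure]
  refine sum_congr rfl fun j hj => ?_
  have hj' : j ≤ n := Nat.lt_succ_iff.1 (mem_range.1 hj)
  rw [lintegral_smul_measure, lintegral_dirac' _ hf, smul_eq_mul, Nat.cast_sub hj', mul_assoc]
  congr 3
  ring

open Finset in
theorem integral_comp_magnetization (n : ℕ) {f : ℝ → ℝ} (hf : Measurable f) :
    ∫ x, f (magnetization x) ∂(Measure.pi fun _ : Fin n => symmetricBernoulli) =
      (2⁻¹ : ℝ) ^ n * ∑ j ∈ range (n + 1), (n.choose j : ℝ) * f (2 * (j : ℝ) - n) := by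
  have hmag : Measurable (magnetization (n := n)) := by unfold magnetization; fun_prop
  rw [← integral_map hmag.aemeasurable hf.aestronglyMeasurable, map_magnetization,
    integral_finsetSum_measure, mul_sum]
  · refine sum_congr rfl fun j _ => ?_
    rw [integral_smul_measure, integral_dirac]
    simp
    ring
  · intro j _
    refine Integrable.smul_measure (integrable_dirac (by simp)) ?_
    exact ENNReal.mul_ne_top (by simp) (by simp)

/-! ### Curie–Weiss probabilities as ratios of weight sums -/

/-- The unnormalised Curie–Weiss weight at `β = 1` of the configurations with `j` spins up. -/
noncomputable def curieWeissWeight (n j : ℕ) : ℝ :=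
  (n.choose j : ℝ) * Real.exp ((2 * (j : ℝ) - n) ^ 2 / (2 * n))

theorem curieWeissWeight_pos {n j : ℕ} (h : j ≤ n) : 0 < curieWeissWeight n j :=
  mul_pos (by exact_mod_cast Nat.choose_pos h) (Real.exp_pos _)

theorem curieWeissWeight_symm {n j : ℕ} (h : j ≤ n) :
    curieWeissWeight n (n - j) = curieWeissWeight n j := by
  unfold curieWeissWeight
  rw [Nat.choose_symm h, Nat.cast_sub h]
  congr 3
  ring

open Finset in
theorem curieWeissMeasure_real_magnetization_mem (n : ℕ) {s : Set ℝ} (hs : MeasurableSet s)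
    [DecidablePred fun j : ℕ => 2 * (j : ℝ) - n ∈ s] :
    (curieWeissMeasure symmetricBernoulli 1 n).real {x | magnetization x ∈ s} =
      (∑ j ∈ range (n + 1) with 2 * ((j : ℕ) : ℝ) - n ∈ s, curieWeissWeight n j) /
        ∑ j ∈ range (n + 1), curieWeissWeight n j := by
  have hmag : Measurable (magnetization (n := n)) := by unfold magnetization; fun_prop
  have hms : MeasurableSet {x : Fin n → ℝ | magnetization x ∈ s} := hmag hs
  set g : ℝ → ℝ := fun y => Real.exp (1 / (2 * (n : ℝ)) * y ^ 2) with hg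
  have hgm : Measurable g := by fun_prop
  have hw : ∀ j : ℕ, (n.choose j : ℝ) * g (2 * (j : ℝ) - n) = curieWeissWeight n j := fun j => by
    simp only [hg, curieWeissWeight]
    congr 2
    ring
  have hZ := integral_comp_magnetization n hgm
  have hA := integral_comp_magnetization n (hgm.indicator hs)
  have hA' : ∫ x in {x : Fin n → ℝ | magnetization x ∈ s}, g (magnetization x)
        ∂(Measure.pi fun _ : Fin n => symmetricBernoulli) =
      (2⁻¹ : ℝ) ^ n * ∑ j ∈ range (n + 1) with 2 * ((j : ℕ) : ℝ) - n ∈ s,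
        curieWeissWeight n j := by
    rw [← integral_indicator hms, sum_filter]
    refine hA.trans ?_
    congr 1
    refine sum_congr rfl fun j _ => ?_
    by_cases h : 2 * (j : ℝ) - n ∈ s
    · simp [h, hw]
    · simp [h]
  simp only [hw] at hZ
  rw [measureReal_def, curieWeissMeasure, tilted_apply_eq_ofReal_integral' _ hms,
    ENNReal.toReal_ofReal (integral_nonneg fun x => by positivity), integral_div]
  change (∫ x in _, g (magnetization x) ∂_) / (∫ x, g (magnetization x) ∂_) = _
  rw [hA', hZ, mul_div_mul_left _ _ (by positivity)]

/-! ### Logarithms of ratios of consecutive weights -/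

theorem two_mul_add_le_log_div {t : ℝ} (h0 : 0 ≤ t) (h1 : t < 1) :
    2 * t + 2 / 3 * t ^ 3 ≤ Real.log ((1 + t) / (1 - t)) := by
  have := Real.sum_range_le_log_div h0 h1 2
  norm_num [Finset.sum_range_succ] at this
  linarith

theorem log_div_le_two_mul_add {t : ℝ} (h0 : 0 ≤ t) (h1 : t ≤ 1 / 2) :
    Real.log ((1 + t) / (1 - t)) ≤ 2 * t + 2 / 3 * t ^ 3 + 3 * t ^ 5 := by
  have := Real.log_div_le_sum_range_add h0 (by linarith) 2
  norm_num [Finset.sum_range_succ] at this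
  have h2 : t ^ 5 / (1 - t ^ 2) ≤ 3 / 2 * t ^ 5 := by
    rw [div_le_iff₀ (by nlinarith)]
    have : 0 ≤ t ^ 5 := by positivity
    nlinarith [mul_nonneg this (show 0 ≤ 1 / 4 - t ^ 2 by nlinarith)]
  linarith

/-- The midpoint m = 2j + 1 - n of two adjacent magnetizations turns the binomial ratio into (1 -
t)/(1 + t) with t = m/(n + 1), whose logarithm has an odd series. -/
theorem log_curieWeissWeight_succ {n j : ℕ} (h : j + 1 ≤ n) :
    Real.log (curieWeissWeight n (j + 1)) - Real.log (curieWeissWeight n j) =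
      2 * (2 * (j : ℝ) + 1 - n) / n -
        Real.log ((1 + (2 * (j : ℝ) + 1 - n) / (n + 1)) /
          (1 - (2 * (j : ℝ) + 1 - n) / (n + 1))) := by
  have hn : (0 : ℝ) < n := by exact_mod_cast (by omega : 0 < n)
  have hj : (j : ℝ) + 1 ≤ n := by exact_mod_cast h
  have hc : ((n.choose (j + 1) : ℕ) : ℝ) * (j + 1) = n.choose j * (n - j) := by
    have := Nat.choose_succ_right_eq n j
    rw [← Nat.cast_sub (by omega : j ≤ n)]
    exact_mod_cast this
  have hp1 : (0 : ℝ) < n.choose (j + 1) := by exact_mod_cast Nat.choose_pos h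
  have hp0 : (0 : ℝ) < n.choose j := by exact_mod_cast Nat.choose_pos (by omega : j ≤ n)
  have hq : (1 + (2 * (j : ℝ) + 1 - n) / (n + 1)) / (1 - (2 * (j : ℝ) + 1 - n) / (n + 1)) =
      (n.choose j : ℝ) / n.choose (j + 1) := by
    have h1 : (1 - (2 * (j : ℝ) + 1 - n) / (n + 1)) = 2 * (n - j) / (n + 1) := by
      field_simp; ring
    have h2 : (1 + (2 * (j : ℝ) + 1 - n) / (n + 1)) = 2 * (j + 1) / (n + 1) := by
      field_simp; ring
    have h3 : (0 : ℝ) < n - j := by linarith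
    rw [h1, h2, div_div_div_cancel_right₀ (by positivity), mul_div_mul_left _ _ two_ne_zero,
      div_eq_div_iff h3.ne' hp1.ne']
    linarith
  rw [hq, Real.log_div hp0.ne' hp1.ne', curieWeissWeight, curieWeissWeight,
    Real.log_mul hp1.ne' (Real.exp_pos _).ne', Real.log_mul hp0.ne' (Real.exp_pos _).ne',
    Real.log_exp, Real.log_exp]
  push_cast
  field_simp
  ring

/-- Criticality: the linear terms 2m/N and 2m/(N + 1) nearly cancel. Only N + 1 ≤ 2N is used in the
cubic term, which loses a factor 8 but allows every m up to N. -/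
theorem drift_le {N m : ℝ} (hN : 1 ≤ N) (h0 : 0 ≤ m) (h1 : m ≤ N) :
    2 * m / N - Real.log ((1 + m / (N + 1)) / (1 - m / (N + 1))) ≤
      2 * m / N ^ 2 - m ^ 3 / (12 * N ^ 3) := by
  have h := two_mul_add_le_log_div (t := m / (N + 1)) (by positivity)
    ((div_lt_one (by positivity)).2 (by linarith))
  have e1 : 2 * m / N - 2 * (m / (N + 1)) ≤ 2 * m / N ^ 2 := by
    rw [← sub_nonneg]
    have : 2 * m / N ^ 2 - (2 * m / N - 2 * (m / (N + 1))) = 2 * m / (N ^ 2 * (N + 1)) := by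
      field_simp; ring
    rw [this]; positivity
  have e2 : m ^ 3 / (12 * N ^ 3) ≤ 2 / 3 * (m / (N + 1)) ^ 3 := by
    rw [div_pow, ← mul_div_assoc, div_le_div_iff₀ (by positivity) (by positivity)]
    have : (N + 1) ^ 3 ≤ (2 * N) ^ 3 := by gcongr; linarith
    have := mul_le_mul_of_nonneg_left this (pow_nonneg h0 3)
    nlinarith
  linarith

/-- The compensator 2(m³ + m)/(3N³) is exactly the increment of k⁴/(12N³) from k = m - 1 to k = m +
1, so it telescopes when the steps are summed. -/
theorem abs_drift_add_le {N m : ℝ} (hN : 1 ≤ N) (h0 : 0 ≤ m) (h1 : m ≤ N / 2) :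
    |2 * m / N - Real.log ((1 + m / (N + 1)) / (1 - m / (N + 1))) +
      2 * (m ^ 3 + m) / (3 * N ^ 3)| ≤ 5 * m / N ^ 2 + 3 * m ^ 5 / N ^ 5 := by
  have hN0 : 0 < N := by linarith
  have hlo := two_mul_add_le_log_div (t := m / (N + 1)) (by positivity)
    ((div_lt_one (by positivity)).2 (by linarith))
  have hhi := log_div_le_two_mul_add (t := m / (N + 1)) (by positivity)
    ((div_le_iff₀ (by positivity)).2 (by linarith))
  have e1 : 2 * m / N - 2 * (m / (N + 1)) ≤ 2 * m / N ^ 2 := by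
    rw [← sub_nonneg]
    have : 2 * m / N ^ 2 - (2 * m / N - 2 * (m / (N + 1))) = 2 * m / (N ^ 2 * (N + 1)) := by
      field_simp; ring
    rw [this]; positivity
  have e1' : 2 * (m / (N + 1)) ≤ 2 * m / N := by
    rw [mul_div_assoc]; gcongr; linarith
  have e2' : 2 / 3 * (m / (N + 1)) ^ 3 ≤ 2 * m ^ 3 / (3 * N ^ 3) := by
    rw [div_pow, ← div_mul_div_comm]; gcongr; linarith
  have e2 : 2 * m ^ 3 / (3 * N ^ 3) - 2 / 3 * (m / (N + 1)) ^ 3 ≤ 2 * m / N ^ 2 := by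
    have h3 : m ^ 3 ≤ m * N ^ 2 := by
      have : m ^ 2 ≤ N ^ 2 := by gcongr; linarith
      nlinarith
    have : 2 * m ^ 3 / (3 * N ^ 3) - 2 / 3 * (m / (N + 1)) ^ 3 =
        2 / 3 * m ^ 3 * ((3 * N ^ 2 + 3 * N + 1) / (N ^ 3 * (N + 1) ^ 3)) := by
      field_simp; ring
    rw [this]
    calc _ ≤ 2 / 3 * (m * N ^ 2) * ((3 * (N + 1) ^ 2) / (N ^ 3 * (N + 1) ^ 3)) := by
          gcongr; nlinarith
      _ = 2 * m / (N * (N + 1)) := by field_simp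
      _ ≤ _ := by gcongr; nlinarith
  have e3 : 2 * m / (3 * N ^ 3) ≤ m / N ^ 2 := by
    rw [div_le_div_iff₀ (by positivity) (by positivity)]
    have : m * N ^ 2 ≤ m * N ^ 3 := by
      gcongr
      norm_num
    nlinarith [mul_nonneg h0 (pow_nonneg hN0.le 3)]
  have e4 : 3 * (m / (N + 1)) ^ 5 ≤ 3 * m ^ 5 / N ^ 5 := by
    rw [div_pow, ← mul_div_assoc]; gcongr; linarith
  have e5 : 2 * (m ^ 3 + m) / (3 * N ^ 3) = 2 * m ^ 3 / (3 * N ^ 3) + 2 * m / (3 * N ^ 3) := by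
    ring
  have e6 : 5 * m / N ^ 2 = 2 * m / N ^ 2 + 2 * m / N ^ 2 + m / N ^ 2 := by ring
  have e7 : 0 ≤ m / N ^ 2 := by positivity
  have e8 : 0 ≤ 3 * m ^ 5 / N ^ 5 := by positivity
  have e9 : 0 ≤ 2 * m / (3 * N ^ 3) := by positivity
  have e10 : 2 * m / N ^ 2 = 2 * (m / N ^ 2) := by ring
  rw [abs_le, e5, e6]
  constructor <;> linarith

/-! ### Quartic behaviour of the log-weights -/

/-- The number of up spins of the most balanced configurations with nonnegative magnetization. -/
def balancedUpSpins (n : ℕ) : ℕ := (n + 1) / 2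

theorem log_weight_sub_le {n j : ℕ} (hn : 1 ≤ n) (hj : balancedUpSpins n ≤ j) (hjn : j ≤ n) :
    Real.log (curieWeissWeight n j) - Real.log (curieWeissWeight n (balancedUpSpins n)) ≤
      (2 * (j : ℝ) - n) ^ 2 / n ^ 2 + 1 / 96 - (2 * (j : ℝ) - n) ^ 4 / (96 * n ^ 3) := by
  have hN : (1 : ℝ) ≤ n := by exact_mod_cast hn
  have hN0 : (0 : ℝ) < n := by linarith
  induction j, hj using Nat.le_induction with
  | base =>
    have h0 : (0 : ℝ) ≤ 2 * (balancedUpSpins n : ℝ) - n := by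
      rw [sub_nonneg]; exact_mod_cast (by unfold balancedUpSpins; omega)
    have h1 : 2 * (balancedUpSpins n : ℝ) - n ≤ 1 := by
      rw [sub_le_iff_le_add]
      exact_mod_cast (by unfold balancedUpSpins; omega)
    set k := 2 * (balancedUpSpins n : ℝ) - n
    -- Here k is 0 or 1 according to the parity of n; the term 1/96 in the bound pays for the odd
    -- case.
    have : k ^ 4 / (96 * (n : ℝ) ^ 3) ≤ 1 / 96 := by
      apply div_le_div₀ <;> first | positivity | skip
      · exact pow_le_one₀ h0 h1
      · nlinarith [one_le_pow₀ hN (n := 3)]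
    have : 0 ≤ k ^ 2 / (n : ℝ) ^ 2 := by positivity
    linarith
  | succ j hj ih =>
    have ih := ih (by omega)
    have hs := log_curieWeissWeight_succ hjn
    have hm0 : (0 : ℝ) ≤ 2 * (j : ℝ) + 1 - n := by
      rw [sub_nonneg]
      exact_mod_cast (by unfold balancedUpSpins at hj; omega)
    have hm1 : 2 * (j : ℝ) + 1 - n ≤ n := by
      have : (j : ℝ) + 1 ≤ n := by exact_mod_cast hjn
      linarith
    have hd := drift_le hN hm0 hm1
    obtain ⟨m, hm⟩ : ∃ m : ℝ, m = 2 * (j : ℝ) + 1 - n := ⟨_, rfl⟩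
    have e0 : 2 * (j : ℝ) - n = m - 1 := by rw [hm]; ring
    have e1 : 2 * ((j + 1 : ℕ) : ℝ) - n = m + 1 := by rw [hm]; push_cast; ring
    rw [← hm] at hs hm0 hm1 hd
    rw [e0] at ih
    rw [e1]
    -- The quadratic term grows by 4m/n², twice what the drift requires; the surplus absorbs the
    -- lower-order part m/(12n³) of the quartic increment.
    have key : (m + 1) ^ 2 / (n : ℝ) ^ 2 - (m + 1) ^ 4 / (96 * (n : ℝ) ^ 3)
        - ((m - 1) ^ 2 / (n : ℝ) ^ 2 - (m - 1) ^ 4 / (96 * (n : ℝ) ^ 3))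
        - (2 * m / (n : ℝ) ^ 2 - m ^ 3 / (12 * (n : ℝ) ^ 3)) = m * (24 * n - 1) / (12 * n ^ 3) := by
      field_simp; ring
    have : 0 ≤ m * (24 * n - 1) / (12 * (n : ℝ) ^ 3) :=
      div_nonneg (mul_nonneg hm0 (by linarith)) (by positivity)
    linarith

theorem abs_log_weight_sub_add_le {n j : ℕ} (hn : 1 ≤ n) (hj : balancedUpSpins n ≤ j)
    (hjn : j ≤ n) (hk : 2 * (j : ℝ) - n ≤ n / 2) :
    |Real.log (curieWeissWeight n j) - Real.log (curieWeissWeight n (balancedUpSpins n)) +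
        (2 * (j : ℝ) - n) ^ 4 / (12 * n ^ 3)| ≤
      5 * (2 * (j : ℝ) - n) ^ 2 / (4 * n ^ 2) + (2 * (j : ℝ) - n) ^ 6 / (4 * n ^ 5) +
        1 / (12 * n ^ 3) := by
  have hN : (1 : ℝ) ≤ n := by exact_mod_cast hn
  have hN0 : (0 : ℝ) < n := by linarith
  induction j, hj using Nat.le_induction with
  | base =>
    have h0 : (0 : ℝ) ≤ 2 * (balancedUpSpins n : ℝ) - n := by
      rw [sub_nonneg]; exact_mod_cast (by unfold balancedUpSpins; omega)
    have h1 : 2 * (balancedUpSpins n : ℝ) - n ≤ 1 := by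
      rw [sub_le_iff_le_add]
      exact_mod_cast (by unfold balancedUpSpins; omega)
    set k := 2 * (balancedUpSpins n : ℝ) - n
    have h2 : k ^ 4 / (12 * (n : ℝ) ^ 3) ≤ 1 / (12 * (n : ℝ) ^ 3) := by
      gcongr
      exact pow_le_one₀ h0 h1
    have h3 : 0 ≤ 5 * k ^ 2 / (4 * (n : ℝ) ^ 2) := by positivity
    have h4 : 0 ≤ k ^ 6 / (4 * (n : ℝ) ^ 5) := by positivity
    rw [sub_self, zero_add, abs_of_nonneg (by positivity)]
    linarith
  | succ j hj ih =>
    have hm2 : 2 * (j : ℝ) + 1 - n ≤ n / 2 := by push_cast at hk; linarith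
    have ih := ih (by omega) (by linarith)
    have hs := log_curieWeissWeight_succ hjn
    have hm0 : (0 : ℝ) ≤ 2 * (j : ℝ) + 1 - n := by
      rw [sub_nonneg]
      exact_mod_cast (by unfold balancedUpSpins at hj; omega)
    have hd := abs_drift_add_le hN hm0 hm2
    obtain ⟨m, hm⟩ : ∃ m : ℝ, m = 2 * (j : ℝ) + 1 - n := ⟨_, rfl⟩
    have e0 : 2 * (j : ℝ) - n = m - 1 := by rw [hm]; ring
    have e1 : 2 * ((j + 1 : ℕ) : ℝ) - n = m + 1 := by rw [hm]; push_cast; ring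
    rw [← hm] at hs hm0 hd
    rw [e0] at ih
    rw [e1]
    have k1 : (m + 1) ^ 4 / (12 * (n : ℝ) ^ 3) =
        (m - 1) ^ 4 / (12 * (n : ℝ) ^ 3) + 2 * (m ^ 3 + m) / (3 * (n : ℝ) ^ 3) := by
      field_simp; ring
    have k2 : 5 * (m + 1) ^ 2 / (4 * (n : ℝ) ^ 2) =
        5 * (m - 1) ^ 2 / (4 * (n : ℝ) ^ 2) + 5 * m / (n : ℝ) ^ 2 := by
      field_simp; ring
    -- The sextic term is chosen so that its increment dominates the quintic error of the drift; the
    -- remainder is nonnegative.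
    have k3 : (m + 1) ^ 6 / (4 * (n : ℝ) ^ 5) = (m - 1) ^ 6 / (4 * (n : ℝ) ^ 5) +
        3 * m ^ 5 / (n : ℝ) ^ 5 + (10 * m ^ 3 + 3 * m) / (n : ℝ) ^ 5 := by
      field_simp; ring
    have k4 : 0 ≤ (10 * m ^ 3 + 3 * m) / (n : ℝ) ^ 5 := by positivity
    rw [← hs] at hd
    have htri := abs_add_le
      (Real.log (curieWeissWeight n j) - Real.log (curieWeissWeight n (balancedUpSpins n)) +
        (m - 1) ^ 4 / (12 * (n : ℝ) ^ 3))
      (Real.log (curieWeissWeight n (j + 1)) - Real.log (curieWeissWeight n j) +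
        2 * (m ^ 3 + m) / (3 * (n : ℝ) ^ 3))
    rw [k1, k2, k3]
    refine le_trans (le_of_eq ?_) (htri.trans (by linarith))
    congr 1
    ring

/-! ### Pointwise comparison of weights with the limit density -/

theorem abs_exp_sub_exp_le_of_le {a b c : ℝ} (ha : a ≤ c) (hb : b ≤ c) :
    |Real.exp a - Real.exp b| ≤ Real.exp c * |a - b| := by
  wlog h : b ≤ a generalizing a b
  · rw [abs_sub_comm, abs_sub_comm a]
    exact this hb ha (le_of_not_ge h)
  rw [abs_of_nonneg (sub_nonneg.2 (Real.exp_le_exp.2 h)), abs_of_nonneg (sub_nonneg.2 h)]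
  have h1 : Real.exp a - Real.exp b = Real.exp a * (1 - Real.exp (b - a)) := by
    rw [mul_sub, ← Real.exp_add]; ring_nf
  rw [h1]
  have := Real.add_one_le_exp (b - a)
  exact mul_le_mul (Real.exp_le_exp.2 ha) (by linarith)
    (sub_nonneg.2 (Real.exp_le_one_iff.2 (by linarith))) (Real.exp_pos _).le

/-- Half the decay rate of the crude bound is not needed: exp s ≥ 1 + s + s²/2 at s = y⁴/96
suffices, and 129024 = 7 · 2 · 96². The majorant 1/(1 + y²) has an explicit primitive. -/
theorem poly_mul_exp_neg_quartic_le (y : ℝ) :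
    (1 + 2 * y ^ 2 + y ^ 6) * Real.exp (-y ^ 4 / 96) ≤ 129024 * (1 + y ^ 2)⁻¹ := by
  rw [← div_eq_mul_inv, le_div_iff₀ (by positivity), neg_div, Real.exp_neg,
    mul_right_comm, ← div_eq_mul_inv, div_le_iff₀ (Real.exp_pos _)]
  have h := Real.quadratic_le_exp_of_nonneg (show 0 ≤ y ^ 4 / 96 by positivity)
  have h1 : (1 + 2 * y ^ 2 + y ^ 6) * (1 + y ^ 2) ≤ 7 * (1 + y ^ 8) := by
    have : 0 ≤ y ^ 2 := sq_nonneg y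
    nlinarith [sq_nonneg (y ^ 2 - 1), sq_nonneg (y ^ 4 - 1), sq_nonneg (y ^ 4 - y ^ 2)]
  have h2 : 0 ≤ y ^ 4 := by positivity
  nlinarith

theorem abs_pow_four_sub_le {p r δ : ℝ} (hδ : |p - r| ≤ δ) (hδ1 : δ ≤ 1) :
    |p ^ 4 - r ^ 4| ≤ δ * (5 * (1 + 2 * p ^ 2 + p ^ 6)) := by
  have h0 : 0 ≤ δ := (abs_nonneg _).trans hδ
  have hr : |r| ≤ |p| + 1 := by
    have := abs_sub_abs_le_abs_sub r p
    rw [abs_sub_comm] at this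
    linarith
  have hp := abs_nonneg p
  have hr0 := abs_nonneg r
  have e : p ^ 4 - r ^ 4 = (p - r) * ((p + r) * (p ^ 2 + r ^ 2)) := by ring
  rw [e, abs_mul, abs_mul, abs_of_nonneg (by positivity : 0 ≤ p ^ 2 + r ^ 2)]
  have h6 : p ^ 6 = |p| ^ 6 := by rw [← abs_pow, abs_of_nonneg (by positivity)]
  rw [h6, ← sq_abs p, ← sq_abs r]
  have hs := abs_add_le p r
  generalize |p| = a at *
  generalize |r| = b at *
  have h1 : |p + r| * (a ^ 2 + b ^ 2) ≤ (a + (a + 1)) * (a ^ 2 + (a + 1) ^ 2) := by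
    gcongr
    linarith
  refine mul_le_mul hδ (h1.trans ?_) (by positivity) h0
  nlinarith [sq_nonneg (a ^ 3 - 1), sq_nonneg (a - 1), pow_nonneg hp 6]

theorem inv_one_add_sq_le {x y : ℝ} (h : |x - y| ≤ 1) :
    (1 + y ^ 2)⁻¹ ≤ 3 * (1 + x ^ 2)⁻¹ := by
  rw [← div_eq_mul_inv, inv_eq_one_div, div_le_div_iff₀ (by positivity) (by positivity)]
  have := abs_le.1 h
  nlinarith [sq_nonneg (x - 2 * y), sq_abs (x - y), sq_nonneg y, abs_nonneg (x - y)]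

theorem exp_neg_quartic_le (y : ℝ) : Real.exp (-y ^ 4 / 12) ≤ Real.exp (-y ^ 4 / 96) := by
  apply Real.exp_le_exp.2
  have : 0 ≤ y ^ 4 := by positivity
  linarith

theorem abs_exp_neg_quartic_sub_le {x y δ : ℝ} (hδ : |x - y| ≤ δ) (hδ1 : δ ≤ 1) :
    |Real.exp (-y ^ 4 / 12) - Real.exp (-x ^ 4 / 12)| ≤
      215040 * δ * (1 + x ^ 2)⁻¹ := by
  have hδ' : |y - x| ≤ δ := by rwa [abs_sub_comm]
  have h0 : 0 ≤ δ := (abs_nonneg _).trans hδ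
  have hab : |-y ^ 4 / 12 - -x ^ 4 / 12| = |y ^ 4 - x ^ 4| / 12 := by
    rw [show -y ^ 4 / 12 - -x ^ 4 / 12 = -((y ^ 4 - x ^ 4) / 12) by ring, abs_neg, abs_div]
    norm_num
  have hx : |y ^ 4 - x ^ 4| * Real.exp (-x ^ 4 / 12) ≤ 645120 * δ * (1 + x ^ 2)⁻¹ := by
    rw [abs_sub_comm]
    calc _ ≤ δ * (5 * (1 + 2 * x ^ 2 + x ^ 6)) * Real.exp (-x ^ 4 / 96) :=
          mul_le_mul (abs_pow_four_sub_le hδ hδ1) (exp_neg_quartic_le x) (Real.exp_pos _).le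
            (by positivity)
      _ = 5 * δ * ((1 + 2 * x ^ 2 + x ^ 6) * Real.exp (-x ^ 4 / 96)) := by ring
      _ ≤ 5 * δ * (129024 * (1 + x ^ 2)⁻¹) := by
          exact mul_le_mul_of_nonneg_left (poly_mul_exp_neg_quartic_le x) (by positivity)
      _ = _ := by ring
  have hy : |y ^ 4 - x ^ 4| * Real.exp (-y ^ 4 / 12) ≤ 3 * 645120 * δ * (1 + x ^ 2)⁻¹ := by
    calc _ ≤ δ * (5 * (1 + 2 * y ^ 2 + y ^ 6)) * Real.exp (-y ^ 4 / 96) :=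
          mul_le_mul (abs_pow_four_sub_le hδ' hδ1) (exp_neg_quartic_le y) (Real.exp_pos _).le
            (by positivity)
      _ = 5 * δ * ((1 + 2 * y ^ 2 + y ^ 6) * Real.exp (-y ^ 4 / 96)) := by ring
      _ ≤ 5 * δ * (129024 * (3 * (1 + x ^ 2)⁻¹)) := by
          refine mul_le_mul_of_nonneg_left ((poly_mul_exp_neg_quartic_le y).trans ?_)
            (by positivity)
          exact mul_le_mul_of_nonneg_left (inv_one_add_sq_le (hδ.trans hδ1)) (by norm_num)
      _ = _ := by ring
  have hmax : |Real.exp (-y ^ 4 / 12) - Real.exp (-x ^ 4 / 12)| ≤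
      (Real.exp (-x ^ 4 / 12) + Real.exp (-y ^ 4 / 12)) * (|y ^ 4 - x ^ 4| / 12) := by
    have hm := abs_exp_sub_exp_le_of_le (le_max_left (-y ^ 4 / 12) (-x ^ 4 / 12))
      (le_max_right _ _)
    rw [hab] at hm
    refine hm.trans ?_
    gcongr
    rcases max_choice (-y ^ 4 / 12) (-x ^ 4 / 12) with h | h <;> rw [h]
    · linarith [Real.exp_pos (-x ^ 4 / 12)]
    · linarith [Real.exp_pos (-y ^ 4 / 12)]
  have hI : 0 < (1 + x ^ 2)⁻¹ := by positivity
  linarith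

/-- For |y| ≤ q/2 the local expansion applies; beyond that both quantities are below the crude
bound, and the factor 4(1 + 2y² + y⁶)/q² exceeds 1 anyway. -/
theorem abs_sub_exp_neg_quartic_le {q u y : ℝ} (hq : 1 ≤ q) (hu : 0 < u)
    (hup : Real.log u ≤ 2 - y ^ 4 / 96)
    (hlog : |y| ≤ q / 2 → |Real.log u + y ^ 4 / 12| ≤ (1 + 2 * y ^ 2 + y ^ 6) / q ^ 2) :
    |u - Real.exp (-y ^ 4 / 12)| ≤ Real.exp 2 * 516096 / q ^ 2 * (1 + y ^ 2)⁻¹ := by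
  have hq0 : 0 < q := by linarith
  have hy4 : 0 ≤ y ^ 4 := by positivity
  have hE : Real.exp (2 - y ^ 4 / 96) = Real.exp 2 * Real.exp (-y ^ 4 / 96) := by
    rw [← Real.exp_add]; ring_nf
  have key : |u - Real.exp (-y ^ 4 / 12)| ≤
      Real.exp (2 - y ^ 4 / 96) * (4 * (1 + 2 * y ^ 2 + y ^ 6) / q ^ 2) := by
    rcases le_or_gt |y| (q / 2) with h | h
    · have h1 := abs_exp_sub_exp_le_of_le hup (show -y ^ 4 / 12 ≤ 2 - y ^ 4 / 96 by linarith)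
      rw [Real.exp_log hu] at h1
      refine h1.trans ?_
      gcongr
      have h2 : Real.log u - -y ^ 4 / 12 = Real.log u + y ^ 4 / 12 := by ring
      rw [h2]
      refine (hlog h).trans ?_
      gcongr
      nlinarith [sq_nonneg y, (by positivity : 0 ≤ y ^ 6)]
    · have h1 : u ≤ Real.exp (2 - y ^ 4 / 96) := by
        rw [← Real.exp_log hu]; exact Real.exp_le_exp.2 hup
      have h2 : Real.exp (-y ^ 4 / 12) ≤ Real.exp (2 - y ^ 4 / 96) :=
        Real.exp_le_exp.2 (by linarith)
      have h3 : 1 ≤ 4 * (1 + 2 * y ^ 2 + y ^ 6) / q ^ 2 := by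
        rw [one_le_div (by positivity)]
        have : (q / 2) ^ 2 ≤ |y| ^ 2 := by gcongr
        rw [sq_abs] at this
        nlinarith [(by positivity : 0 ≤ y ^ 6)]
      calc _ ≤ Real.exp (2 - y ^ 4 / 96) := by
            rw [abs_le]
            constructor <;> linarith [Real.exp_pos (-y ^ 4 / 12)]
        _ ≤ _ := le_mul_of_one_le_right (Real.exp_pos _).le h3
  refine key.trans ?_
  rw [hE]
  calc _ = Real.exp 2 * 4 / q ^ 2 * ((1 + 2 * y ^ 2 + y ^ 6) * Real.exp (-y ^ 4 / 96)) := by ring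
    _ ≤ Real.exp 2 * 4 / q ^ 2 * (129024 * (1 + y ^ 2)⁻¹) := by
        exact mul_le_mul_of_nonneg_left (poly_mul_exp_neg_quartic_le y) (by positivity)
    _ = _ := by ring

/-- The constant in the pointwise comparison of the Curie–Weiss weights with the limit density. -/
noncomputable def localConst : ℝ := Real.exp 2 * 1548288 + 215040

theorem localConst_pos : 0 < localConst := by unfold localConst; positivity

theorem abs_weight_div_sub_le {n j : ℕ} {q x : ℝ} (hq : 1 ≤ q) (hqn : q ^ 4 = n) (hjn : j ≤ n)
    (hx : |x - (2 * (j : ℝ) - n) / q ^ 3| ≤ 1 / q ^ 3) :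
    |curieWeissWeight n j / curieWeissWeight n (balancedUpSpins n) - Real.exp (-x ^ 4 / 12)| ≤
      localConst / q ^ 2 * (1 + x ^ 2)⁻¹ := by
  have hq0 : 0 < q := by linarith
  have hn : 1 ≤ n := by
    have : (1 : ℝ) ≤ n := hqn ▸ one_le_pow₀ hq
    exact_mod_cast this
  -- Spin flip: j ↦ n - j together with x ↦ -x.
  wlog hj : balancedUpSpins n ≤ j generalizing j x
  · have h1 : |-x - (2 * ((n - j : ℕ) : ℝ) - n) / q ^ 3| ≤ 1 / q ^ 3 := by
      rw [Nat.cast_sub hjn, ← abs_neg]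
      convert hx using 2
      ring
    have := this (j := n - j) (x := -x) (Nat.sub_le _ _) h1
      (by unfold balancedUpSpins at *; omega)
    rw [curieWeissWeight_symm hjn] at this
    have e4 : (-x) ^ 4 = x ^ 4 := by ring
    rwa [neg_sq, e4] at this
  set y := (2 * (j : ℝ) - n) / q ^ 3 with hy
  set u := curieWeissWeight n j / curieWeissWeight n (balancedUpSpins n) with hu
  have hw := curieWeissWeight_pos hjn
  have hw0 : 0 < curieWeissWeight n (balancedUpSpins n) :=
    curieWeissWeight_pos (by unfold balancedUpSpins; omega)
  have hk : 2 * (j : ℝ) - n = y * q ^ 3 := by rw [hy]; field_simp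
  have hk0 : 0 ≤ 2 * (j : ℝ) - n := by
    rw [sub_nonneg]; exact_mod_cast (by unfold balancedUpSpins at hj; omega)
  have hkn : 2 * (j : ℝ) - n ≤ n := by
    have : (j : ℝ) ≤ n := by exact_mod_cast hjn
    linarith
  have hlogu : Real.log u = Real.log (curieWeissWeight n j) -
      Real.log (curieWeissWeight n (balancedUpSpins n)) := Real.log_div hw.ne' hw0.ne'
  have hy0 : 0 ≤ y := div_nonneg hk0 (by positivity)
  have hyq : y ≤ q := by
    rw [hk, ← hqn] at hkn
    have : y * q ^ 3 ≤ q * q ^ 3 := by linarith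
    exact le_of_mul_le_mul_right this (by positivity)
  have hup : Real.log u ≤ 2 - y ^ 4 / 96 := by
    have h := log_weight_sub_le hn hj hjn
    rw [← hlogu, hk, ← hqn] at h
    have e1 : (y * q ^ 3) ^ 2 / (q ^ 4) ^ 2 = y ^ 2 / q ^ 2 := by field_simp
    have e2 : (y * q ^ 3) ^ 4 / (96 * (q ^ 4) ^ 3) = y ^ 4 / 96 := by field_simp
    rw [e1, e2] at h
    have : y ^ 2 / q ^ 2 ≤ 1 := (div_le_one (by positivity)).2 (by gcongr)
    linarith
  have hlog : |y| ≤ q / 2 → |Real.log u + y ^ 4 / 12| ≤ (1 + 2 * y ^ 2 + y ^ 6) / q ^ 2 := by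
    intro hyq2
    rw [abs_of_nonneg hy0] at hyq2
    have hk2 : 2 * (j : ℝ) - n ≤ n / 2 := by
      rw [hk, ← hqn]
      have : y * q ^ 3 ≤ q / 2 * q ^ 3 := by gcongr
      linarith
    have h := abs_log_weight_sub_add_le hn hj hjn hk2
    rw [← hlogu, hk, ← hqn] at h
    have e1 : 5 * (y * q ^ 3) ^ 2 / (4 * (q ^ 4) ^ 2) = 5 / 4 * y ^ 2 / q ^ 2 := by field_simp
    have e2 : (y * q ^ 3) ^ 4 / (12 * (q ^ 4) ^ 3) = y ^ 4 / 12 := by field_simp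
    have e3 : (y * q ^ 3) ^ 6 / (4 * (q ^ 4) ^ 5) = 1 / 4 * y ^ 6 / q ^ 2 := by field_simp
    have e4 : 1 / (12 * (q ^ 4) ^ 3) ≤ 1 / q ^ 2 := by
      apply one_div_le_one_div_of_le (by positivity)
      have := one_le_pow₀ hq (n := 10)
      have : q ^ 2 * 1 ≤ q ^ 2 * (12 * q ^ 10) := by gcongr; linarith
      calc q ^ 2 = q ^ 2 * 1 := by ring
        _ ≤ _ := this
        _ = _ := by ring
    rw [e1, e2, e3] at h
    refine h.trans ((add_le_add_right e4 _).trans ?_)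
    rw [← add_div, ← add_div]
    refine div_le_div_of_nonneg_right ?_ (by positivity)
    have h2 : 0 ≤ y ^ 2 := sq_nonneg y
    have h6 : 0 ≤ y ^ 6 := by positivity
    clear_value y
    linarith
  have h1 := abs_sub_exp_neg_quartic_le hq (div_pos hw hw0) hup hlog
  have hδ : 1 / q ^ 3 ≤ 1 := (div_le_one (by positivity)).2 (one_le_pow₀ hq)
  have h2 := abs_exp_neg_quartic_sub_le hx hδ
  have h3 := inv_one_add_sq_le (hx.trans hδ)
  have h4 : 1 / q ^ 3 ≤ 1 / q ^ 2 :=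
    one_div_le_one_div_of_le (by positivity) (pow_le_pow_right₀ hq (by norm_num))
  calc |u - Real.exp (-x ^ 4 / 12)|
      ≤ |u - Real.exp (-y ^ 4 / 12)| + |Real.exp (-y ^ 4 / 12) - Real.exp (-x ^ 4 / 12)| :=
        abs_sub_le _ _ _
    _ ≤ Real.exp 2 * 516096 / q ^ 2 * (3 * (1 + x ^ 2)⁻¹) +
        215040 * (1 / q ^ 2) * (1 + x ^ 2)⁻¹ := by
        refine add_le_add (h1.trans ?_) (h2.trans ?_) <;> gcongr
    _ = _ := by unfold localConst; ring

/-! ### Integrals and tails of the limit density -/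

theorem integrable_exp_neg_quartic : Integrable fun x : ℝ => Real.exp (-x ^ 4 / 12) := by
  refine (integrable_inv_one_add_sq.const_mul 129024).mono' (by fun_prop)
    (Filter.Eventually.of_forall fun x => ?_)
  rw [Real.norm_eq_abs, Real.abs_exp]
  refine (exp_neg_quartic_le x).trans (le_trans ?_ (poly_mul_exp_neg_quartic_le x))
  refine le_mul_of_one_le_left (Real.exp_pos _).le ?_
  have h2 : 0 ≤ x ^ 2 := sq_nonneg x
  have h6 : 0 ≤ x ^ 6 := by positivity
  linarith

theorem exp_neg_quartic_le_of_le_abs {q x : ℝ} (hq : 0 < q) (hx : q ≤ |x|) :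
    Real.exp (-x ^ 4 / 12) ≤ 129024 / q ^ 2 * (1 + x ^ 2)⁻¹ := by
  rw [div_mul_eq_mul_div, le_div_iff₀ (by positivity), mul_comm]
  refine le_trans ?_ (poly_mul_exp_neg_quartic_le x)
  have : q ^ 2 ≤ |x| ^ 2 := by gcongr
  rw [sq_abs] at this
  refine mul_le_mul ?_ (exp_neg_quartic_le x) (Real.exp_pos _).le (by positivity)
  have h2 : 0 ≤ x ^ 2 := sq_nonneg x
  have h6 : 0 ≤ x ^ 6 := by positivity
  linarith

theorem abs_integral_inv_one_add_sq_le (a b : ℝ) :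
    |∫ x in a..b, (1 + x ^ 2)⁻¹| ≤ Real.pi := by
  rw [integral_inv_one_add_sq, abs_le]
  have := Real.arctan_lt_pi_div_two a
  have := Real.arctan_lt_pi_div_two b
  have := Real.neg_pi_div_two_lt_arctan a
  have := Real.neg_pi_div_two_lt_arctan b
  constructor <;> linarith

theorem abs_integral_exp_neg_quartic_le_of_le_abs {q a b : ℝ} (hq : 0 < q)
    (h : ∀ x ∈ Set.uIoc a b, q ≤ |x|) :
    |∫ x in a..b, Real.exp (-x ^ 4 / 12)| ≤ 129024 * Real.pi / q ^ 2 := by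
  have h1 := intervalIntegral.norm_integral_le_abs_of_norm_le
    (f := fun x : ℝ => Real.exp (-x ^ 4 / 12)) (g := fun x => 129024 / q ^ 2 * (1 + x ^ 2)⁻¹)
    (μ := volume) (a := a) (b := b)
    ((ae_restrict_iff' measurableSet_uIoc).2 (Filter.Eventually.of_forall fun x hx => by
      rw [Real.norm_eq_abs, Real.abs_exp]
      exact exp_neg_quartic_le_of_le_abs hq (h x hx)))
    (integrable_inv_one_add_sq.const_mul _).intervalIntegrable
  rw [Real.norm_eq_abs, intervalIntegral.integral_const_mul, abs_mul] at h1
  refine h1.trans ?_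
  rw [abs_of_pos (by positivity : 0 < 129024 / q ^ 2), mul_div_right_comm]
  exact mul_le_mul_of_nonneg_left (abs_integral_inv_one_add_sq_le a b) (by positivity)

theorem integral_Iic_exp_neg_quartic_le {q a : ℝ} (hq : 0 < q) (ha : a ≤ -q) :
    ∫ x in Set.Iic a, Real.exp (-x ^ 4 / 12) ≤ 129024 * Real.pi / q ^ 2 := by
  have h1 : ∫ x in Set.Iic a, Real.exp (-x ^ 4 / 12) ≤
      ∫ x in Set.Iic a, 129024 / q ^ 2 * (1 + x ^ 2)⁻¹ := by
    refine setIntegral_mono_on integrable_exp_neg_quartic.integrableOn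
      (integrable_inv_one_add_sq.const_mul _).integrableOn measurableSet_Iic fun x hx => ?_
    refine exp_neg_quartic_le_of_le_abs hq ?_
    rw [Set.mem_Iic] at hx
    exact le_abs.2 (Or.inr (by linarith))
  refine h1.trans ?_
  rw [integral_const_mul, integral_Iic_inv_one_add_sq, mul_div_right_comm]
  have := Real.arctan_lt_pi_div_two a
  exact mul_le_mul_of_nonneg_left (by linarith) (by positivity)

/-! ### Partial sums of weights against integrals -/

open Finset in
theorem abs_sum_weights_sub_intervalIntegral_le {n J : ℕ} {q : ℝ} (hq : 1 ≤ q)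
    (hqn : q ^ 4 = n) (hJ : J ≤ n + 1) :
    |∑ j ∈ range J, 2 / q ^ 3 *
          (curieWeissWeight n j / curieWeissWeight n (balancedUpSpins n)) -
        ∫ x in (-1 - n) / q ^ 3..(2 * (J : ℝ) - 1 - n) / q ^ 3, Real.exp (-x ^ 4 / 12)| ≤
      localConst * Real.pi / q ^ 2 := by
  have hq0 : 0 < q := by linarith
  -- The cell edges lie halfway between atoms, so the cells tile without gaps.
  set e : ℕ → ℝ := fun j => (2 * (j : ℝ) - 1 - n) / q ^ 3 with he
  have hee : ∀ j, e (j + 1) - e j = 2 / q ^ 3 := fun j => by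
    simp only [he]; push_cast; ring
  have hle : ∀ j, e j ≤ e (j + 1) := fun j => by
    rw [← sub_nonneg, hee]; positivity
  have e0 : (-1 - n) / q ^ 3 = e 0 := by simp [he]
  have hg : ∀ a b : ℝ, IntervalIntegrable (fun x : ℝ => Real.exp (-x ^ 4 / 12)) volume a b :=
    fun a b => integrable_exp_neg_quartic.intervalIntegrable
  have hr : ∀ a b : ℝ,
      IntervalIntegrable (fun x : ℝ => localConst / q ^ 2 * (1 + x ^ 2)⁻¹) volume a b :=
    fun a b => (integrable_inv_one_add_sq.const_mul _).intervalIntegrable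
  have hcell : ∀ j ∈ range J, |2 / q ^ 3 *
      (curieWeissWeight n j / curieWeissWeight n (balancedUpSpins n)) -
        ∫ x in e j..e (j + 1), Real.exp (-x ^ 4 / 12)| ≤
      ∫ x in e j..e (j + 1), localConst / q ^ 2 * (1 + x ^ 2)⁻¹ := by
    intro j hj
    have hjn : j ≤ n := by have := mem_range.1 hj; omega
    rw [← hee j, ← smul_eq_mul, ← intervalIntegral.integral_const,
      ← intervalIntegral.integral_sub intervalIntegrable_const (hg _ _), ← Real.norm_eq_abs]
    refine intervalIntegral.norm_integral_le_of_norm_le (hle j)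
      (Filter.Eventually.of_forall fun x hx => ?_) (hr _ _)
    refine abs_weight_div_sub_le hq hqn hjn ?_
    have e1 : e j = (2 * (j : ℝ) - n) / q ^ 3 - 1 / q ^ 3 := by simp only [he]; ring
    have e2 : e (j + 1) = (2 * (j : ℝ) - n) / q ^ 3 + 1 / q ^ 3 := by
      simp only [he]; push_cast; ring
    rw [e1, e2] at hx
    rw [abs_le]
    constructor <;> linarith [hx.1, hx.2]
  change |_ - ∫ x in _..e J, _| ≤ _
  rw [e0, ← intervalIntegral.sum_integral_adjacent_intervals (fun j _ => hg _ _),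
    ← sum_sub_distrib]
  refine (abs_sum_le_sum_abs _ _).trans ((sum_le_sum hcell).trans ?_)
  rw [intervalIntegral.sum_integral_adjacent_intervals (fun j _ => hr _ _),
    intervalIntegral.integral_const_mul, mul_div_right_comm]
  have := localConst_pos
  exact mul_le_mul_of_nonneg_left ((le_abs_self _).trans (abs_integral_inv_one_add_sq_le _ _))
    (by positivity)

/-- The constant in the comparison of partial sums of weights with the limit density. -/
noncomputable def partialSumConst : ℝ := localConst * Real.pi + 2 * (129024 * Real.pi) + 1

open Finset in
theorem abs_sum_weights_sub_integral_Iic_le {n J : ℕ} {q z : ℝ} (hq : 1 ≤ q)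
    (hqn : q ^ 4 = n) (hJ : J ≤ n + 1) (hlt : ∀ j < J, (2 * (j : ℝ) - n) / q ^ 3 ≤ z)
    (hge : J ≤ n → z < (2 * (J : ℝ) - n) / q ^ 3) :
    |∑ j ∈ range J, 2 / q ^ 3 *
          (curieWeissWeight n j / curieWeissWeight n (balancedUpSpins n)) -
        ∫ x in Set.Iic z, Real.exp (-x ^ 4 / 12)| ≤ partialSumConst / q ^ 2 := by
  have hq0 : 0 < q := by linarith
  have hcells := abs_sum_weights_sub_intervalIntegral_le hq hqn hJ
  have hint := integrable_exp_neg_quartic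
  set a := (-1 - (n : ℝ)) / q ^ 3 with ha
  set b := (2 * (J : ℝ) - 1 - n) / q ^ 3 with hb
  have haq : a ≤ -q := by
    rw [ha, div_le_iff₀ (by positivity), ← hqn]
    linarith
  have hsplit : ∫ x in Set.Iic z, Real.exp (-x ^ 4 / 12) =
      (∫ x in Set.Iic a, Real.exp (-x ^ 4 / 12)) + (∫ x in a..b, Real.exp (-x ^ 4 / 12)) +
        ∫ x in b..z, Real.exp (-x ^ 4 / 12) := by
    rw [← intervalIntegral.integral_Iic_sub_Iic (hint.integrableOn (s := Set.Iic a))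
        (hint.integrableOn (s := Set.Iic b)),
      ← intervalIntegral.integral_Iic_sub_Iic (hint.integrableOn (s := Set.Iic b))
        (hint.integrableOn (s := Set.Iic z))]
    ring
  have htail := integral_Iic_exp_neg_quartic_le hq0 haq
  have htail0 : 0 ≤ ∫ x in Set.Iic a, Real.exp (-x ^ 4 / 12) :=
    integral_nonneg fun x => (Real.exp_pos _).le
  -- The last cell edge b is within half a cell of z, unless z lies outside the range of the cells;
  -- then the whole interval between b and z is in a tail beyond q.
  have hlow : b - 1 / q ^ 3 ≤ z ∨ z < b ∧ b ≤ -q := by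
    rcases Nat.eq_zero_or_pos J with h | h
    · subst h
      have hba : b = a := by rw [ha, hb]; norm_num
      rcases lt_or_ge z b with h | h
      · exact Or.inr ⟨h, hba ▸ haq⟩
      · left
        have : 0 ≤ 1 / q ^ 3 := by positivity
        linarith
    · left
      have := hlt (J - 1) (by omega)
      rw [Nat.cast_sub h] at this
      refine le_trans (le_of_eq ?_) this
      rw [hb]; push_cast; ring
  have hupp : z ≤ b + 1 / q ^ 3 ∨ q ≤ b := by
    rcases Nat.lt_or_ge n J with h | h
    · right
      have hJ1 : J = n + 1 := by omega
      rw [hb, le_div_iff₀ (by positivity), hJ1]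
      push_cast
      rw [← hqn]
      linarith
    · left
      refine (hge h).le.trans (le_of_eq ?_)
      rw [hb]; ring
  have hlast : |∫ x in b..z, Real.exp (-x ^ 4 / 12)| ≤ (129024 * Real.pi + 1) / q ^ 2 := by
    have h3 : 1 / q ^ 3 ≤ 1 / q ^ 2 :=
      one_div_le_one_div_of_le (by positivity) (pow_le_pow_right₀ hq (by norm_num))
    have hpi : 0 ≤ 129024 * Real.pi / q ^ 2 := by positivity
    have h1 : 0 ≤ 1 / q ^ 2 := by positivity
    rw [add_div]
    by_cases hs : |z - b| ≤ 1 / q ^ 3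
    · have := intervalIntegral.norm_integral_le_of_norm_le_const (a := b) (b := z) (C := 1)
        (f := fun x : ℝ => Real.exp (-x ^ 4 / 12)) fun x _ => by
          rw [Real.norm_eq_abs, Real.abs_exp, Real.exp_le_one_iff]
          have : 0 ≤ x ^ 4 := by positivity
          linarith
      rw [Real.norm_eq_abs] at this
      linarith
    · refine (abs_integral_exp_neg_quartic_le_of_le_abs hq0 fun x hx => ?_).trans
        (le_add_of_nonneg_right h1)
      rw [abs_le, not_and_or, not_le, not_le] at hs
      rw [Set.mem_uIoc] at hx
      have h4 : 0 ≤ 1 / q ^ 3 := by positivity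
      rw [le_abs]
      rcases hs with hs | hs
      · obtain ⟨h5, h6⟩ := hlow.resolve_left (by linarith)
        right
        rcases hx with hx | hx <;> linarith [hx.1, hx.2]
      · have h5 := hupp.resolve_left (by linarith)
        left
        rcases hx with hx | hx <;> linarith [hx.1, hx.2]
  have e : partialSumConst / q ^ 2 = localConst * Real.pi / q ^ 2 +
      129024 * Real.pi / q ^ 2 + (129024 * Real.pi + 1) / q ^ 2 := by
    unfold partialSumConst; ring
  rw [hsplit, e]
  rw [abs_le] at hcells hlast ⊢
  constructor <;> linarith [hcells.1, hcells.2, hlast.1, hlast.2]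

open Finset in
theorem abs_sum_weights_sub_integral_le {n : ℕ} {q : ℝ} (hq : 1 ≤ q) (hqn : q ^ 4 = n) :
    |∑ j ∈ range (n + 1), 2 / q ^ 3 *
          (curieWeissWeight n j / curieWeissWeight n (balancedUpSpins n)) -
        ∫ x, Real.exp (-x ^ 4 / 12)| ≤ partialSumConst / q ^ 2 := by
  have hq0 : 0 < q := by linarith
  have hlim := (aecover_Iic (μ := volume) Filter.tendsto_id).integral_tendsto_of_countably_generated
    integrable_exp_neg_quartic
  refine le_of_tendsto ((tendsto_const_nhds.sub hlim).abs)
    -- Once z is at least n/q³, the largest atom, all atoms are counted, so z can tend to infinity.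
    (Filter.eventually_atTop.2 ⟨n / q ^ 3, fun z hz => ?_⟩)
  refine abs_sum_weights_sub_integral_Iic_le hq hqn le_rfl (fun j hj => le_trans ?_ hz)
    (fun h => by omega)
  have : (j : ℝ) ≤ n := by exact_mod_cast Nat.lt_succ_iff.1 hj
  gcongr
  linarith

/-! ### Normalisation and the uniform bound -/

/-- Since a/A ≤ 1, the error in the denominator counts at most once, and no quantitative lower bound
on A is needed. -/
theorem abs_div_sub_inv_mul_le {a b A Z D : ℝ} (hA : 0 < A) (hZ : 0 < Z) (ha : 0 ≤ a)
    (haA : a ≤ A) (h1 : |a - b| ≤ D) (h2 : |A - Z| ≤ D) :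
    |a / A - Z⁻¹ * b| ≤ 2 * D / Z := by
  have e : a / A - Z⁻¹ * b = (a / A * (Z - A) + (a - b)) / Z := by
    field_simp; ring
  have h3 : |a / A| ≤ 1 := by
    rw [abs_of_nonneg (by positivity)]; exact (div_le_one hA).2 haA
  rw [e, abs_div, abs_of_pos hZ]
  refine div_le_div_of_nonneg_right ((abs_add_le _ _).trans ?_) hZ.le
  rw [abs_mul, abs_sub_comm Z]
  have := mul_le_of_le_one_left (abs_nonneg (A - Z)) h3
  linarith

open Finset in
theorem criticalDiscrepancy_le {n : ℕ} (hn : 1 ≤ n) (z : ℝ) :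
    criticalDiscrepancy n z ≤
      2 * partialSumConst / (∫ x : ℝ, Real.exp (-x ^ 4 / 12)) * (n : ℝ) ^ (-(1 / 2) : ℝ) := by
  have hN : (1 : ℝ) ≤ n := by exact_mod_cast hn
  have hN0 : (0 : ℝ) ≤ n := by linarith
  set q : ℝ := (n : ℝ) ^ (1 / 4 : ℝ) with hqdef
  have hq : 1 ≤ q := Real.one_le_rpow hN (by norm_num)
  have hq0 : 0 < q := by linarith
  have hqn : q ^ 4 = n := by
    rw [hqdef, ← Real.rpow_natCast, ← Real.rpow_mul hN0]; norm_num
  have hq3 : (n : ℝ) ^ (3 / 4 : ℝ) = q ^ 3 := by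
    rw [hqdef, ← Real.rpow_natCast, ← Real.rpow_mul hN0]; norm_num
  have hq2 : (n : ℝ) ^ (-(1 / 2) : ℝ) = 1 / q ^ 2 := by
    rw [hqdef, ← Real.rpow_natCast, ← Real.rpow_mul hN0, Real.rpow_neg hN0, one_div]; norm_num
  have hZ : 0 < ∫ x : ℝ, Real.exp (-x ^ 4 / 12) :=
    integral_exp_pos integrable_exp_neg_quartic
  have hw0 : 0 < curieWeissWeight n (balancedUpSpins n) :=
    curieWeissWeight_pos (by unfold balancedUpSpins; omega)
  set J : ℕ := min (n + 1) ⌊(z * q ^ 3 + n) / 2 + 1⌋₊ with hJ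
  have hmem : ∀ j : ℕ, j < ⌊(z * q ^ 3 + n) / 2 + 1⌋₊ ↔ (2 * (j : ℝ) - n) / q ^ 3 ≤ z := by
    intro j
    -- As j + 1 is nonzero, the floor equivalence holds even for a negative argument.
    rw [← Nat.add_one_le_iff, Nat.le_floor_iff' (by omega), div_le_iff₀ (by positivity)]
    push_cast
    constructor <;> intro h <;> linarith
  have hpart := abs_sum_weights_sub_integral_Iic_le (J := J) (z := z) hq hqn (min_le_left _ _)
    (fun j hj => (hmem j).1 (hj.trans_le (min_le_right _ _)))
    (fun h => by
      by_contra hcon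
      have := (hmem J).2 (not_lt.1 hcon)
      omega)
  have hfull := abs_sum_weights_sub_integral_le hq hqn
  have hu : ∀ j ∈ range (n + 1), 0 < 2 / q ^ 3 *
      (curieWeissWeight n j / curieWeissWeight n (balancedUpSpins n)) := fun j hj =>
    mul_pos (by positivity)
      (div_pos (curieWeissWeight_pos (Nat.lt_succ_iff.1 (mem_range.1 hj))) hw0)
  have hsub : range J ⊆ range (n + 1) := range_subset_range.2 (min_le_left _ _)
  have hprob : (curieWeissMeasure symmetricBernoulli 1 n).real
      {x | magnetization x / (n : ℝ) ^ (3 / 4 : ℝ) ≤ z} =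
      (∑ j ∈ range J, 2 / q ^ 3 *
        (curieWeissWeight n j / curieWeissWeight n (balancedUpSpins n))) /
      ∑ j ∈ range (n + 1), 2 / q ^ 3 *
        (curieWeissWeight n j / curieWeissWeight n (balancedUpSpins n)) := by
    classical
    have hms : MeasurableSet {y : ℝ | y / q ^ 3 ≤ z} :=
      measurableSet_le (by fun_prop) measurable_const
    have h := curieWeissMeasure_real_magnetization_mem n hms
    rw [hq3]
    refine h.trans ?_
    have hfilter : (range (n + 1)).filter
        (fun j : ℕ => 2 * (j : ℝ) - n ∈ {y : ℝ | y / q ^ 3 ≤ z}) = range J := by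
      ext j
      rw [mem_filter, mem_range, mem_range, Set.mem_ofPred_eq, ← hmem, hJ, lt_min_iff]
    rw [hfilter, ← mul_sum, ← mul_sum, ← sum_div, ← sum_div,
      mul_div_mul_left _ _ (by positivity), div_div_div_cancel_right₀ hw0.ne']
  rw [criticalDiscrepancy, quarticCDF, hprob]
  refine (abs_div_sub_inv_mul_le (sum_pos hu ⟨0, by simp⟩) hZ
    (sum_nonneg fun j hj => (hu j (hsub hj)).le)
    (sum_le_sum_of_subset_of_nonneg hsub fun j hj _ => (hu j hj).le) hpart hfull).trans
    (le_of_eq ?_)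
  rw [hq2]
  ring

theorem theorem1p2 :
    ∃ C : ℝ, ∀ n : ℕ, 1 ≤ n →
      BddAbove (Set.range (criticalDiscrepancy n)) ∧
      (⨆ z : ℝ, criticalDiscrepancy n z) ≤ C * (n : ℝ) ^ (-(1 / 2) : ℝ) := by
  refine ⟨2 * partialSumConst / ∫ x : ℝ, Real.exp (-x ^ 4 / 12), fun n hn =>
    ⟨⟨2 * partialSumConst / (∫ x : ℝ, Real.exp (-x ^ 4 / 12)) * (n : ℝ) ^ (-(1 / 2) : ℝ), ?_⟩,
      ciSup_le fun z => criticalDiscrepancy_le hn z⟩⟩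
  rintro _ ⟨z, rfl⟩
  exact criticalDiscrepancy_le hn z
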